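/- Let $X$ be a connected smooth $4$-manifold with basepoint $x_0$ (possibly non-compact, possibly with boundary), let $T_X=\{g\in\pi_1(X,x_0): g^2=1,\ g\ne 1\}$, let $\mathbb F_2T_X$ be the $\mathbb F_2$-vector space with basis $T_X$, and let $\pi:(\widetilde X,\tilde x_0)\to (X,x_0)$ be the universal cover, on which $\pi_1(X,x_0)$ acts by deck transformations. Call a smooth map from a compact $3$-manifold to a $6$-manifold \emph{generic} if it is an immersion, takes interior points to interior points, has no triple points, and its two sheets meet transversally at every double point. Let $V$ be a smooth $2$-manifold ($V=\mathbb R^2$ or $V=\mathbb R\times I$, with $I=[0,1]$), let $M=S^3$ or $M=S^2\times I$, and let $F:M\to X\times V$ be generic, taking the basepoint $m_0$ of $M$ into $\{x_0\}\times V$. To a double point $p=F(x)=F(y)$, $x\neq y$, assign the class $g_p\in\pi_1(X,x_0)$ of the projection to $X$ of the loop $F(a)\,F(b)\,\overline{F(a)}$, where $a$ is an arc in $M$ from $m_0$ to $x$ and $b$ is an arc in $M$ from $x$ to $y$; up to inversion $g_p$ depends only on $p$. Put $\Sigma(F)=\sum_{p:\,g_p\in T_X} g_p\in\mathbb F_2T_X$,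 the sum over the double points of $F$ with $g_p\in T_X$. For a generic map $f:S^3\to X\times\mathbb R^2$ taking the basepoint of $S^3$ into $\{x_0\}\times\mathbb R^2$ (for instance a generic perturbation of a based map $S^3\to X$) let $\mu_3(f)=\Sigma(f)$, and let $\mu_3(\pi_3(X))\subset\mathbb F_2T_X$ be the subspace spanned by all these elements. For based smooth embeddings $S_0,S_1:S^2\to X$ with image in the interior of $X$ and a generic map $H:S^2\times I\to X\times\mathbb R\times I$ with $H(z,0)=(S_0(z),0,0)$, $H(z,1)=(S_1(z),0,1)$ and $H(\{*\}\times I)\subset\{x_0\}\times\mathbb R\times I$ (for instance a generic perturbation of the track of a based homotopy from $S_0$ to $S_1$), let $\mathrm{fq}(S_0,S_1)$ be the class of $\Sigma(H)$ in $\mathbb F_2T_X/\mu_3(\pi_3(X))$, that is, the Freedman--Quinn invariant as computed from $H$. (a) Let $f$ be as above, let $Y_1\subset\widetilde X\times\mathbb R^2$ be the image of the lift of $f$ that takes the basepoint of $S^3$ into $\{\tilde x_0\}\times\mathbb R^2$, and let $Y_g=g\cdot Y_1$ for $g\in\pi_1(X,x_0)$. Then the double points of $f$ and of its lift are isolated and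 finite in number; for every $g\ne1$ the set $Y_1\cap Y_g$ is finite, and it is empty for all but finitely many $g\neq 1$; for $g\in T_X$ the number $|Y_1\cap Y_g|$ is even; and $$\mu_3(f)=\sum_{g\in T_X}\tfrac12|Y_1\cap Y_g|\cdot g\in\mathbb F_2T_X .$$ (b) Let $S_0,S_1,H$ be as above, let $Y_1\subset\widetilde X\times\mathbb R\times I$ be the image of the lift of $H$ that takes $(*,0)$ into $\{\tilde x_0\}\times\mathbb R\times I$, and let $Y_g=g\cdot Y_1$. Then the same finiteness and parity statements hold, and $$\mathrm{fq}(S_0,S_1)=\sum_{g\in T_X}\tfrac12|Y_1\cap Y_g|\cdot g\in\mathbb F_2T_X/\mu_3(\pi_3(X)) .$$ -/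

import Mathlib

open scoped Manifold ContDiff

noncomputable section

namespace FreedmanQuinn

/-- The standard `n`-sphere. -/
abbrev Sph (n : ℕ) : Type := Metric.sphere (0 : EuclideanSpace ℝ (Fin (n + 1))) 1

instance factFinrank (n : ℕ) :
    Fact (Module.finrank ℝ (EuclideanSpace ℝ (Fin (n + 1))) = n + 1) :=
  ⟨finrank_euclideanSpace_fin⟩

/-- The basepoint of the `n`-sphere. -/
def pole (n : ℕ) : Sph n := ⟨EuclideanSpace.single 0 1, by simp⟩

instance pathConnectedSph (n : ℕ) : PathConnectedSpace (Sph (n + 1)) := by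
  refine isPathConnected_iff_pathConnectedSpace.mp (isPathConnected_sphere ?_ 0 zero_le_one)
  rw [← Module.finrank_eq_rank, finrank_euclideanSpace_fin]
  exact_mod_cast (by omega : 1 < n + 1 + 1)

instance pathConnectedCylinder (n : ℕ) : PathConnectedSpace (Sph (n + 1) × unitInterval) := by
  have hI : PathConnectedSpace unitInterval := isPathConnected_iff_pathConnectedSpace.mp
    ((convex_Icc (0 : ℝ) 1).isPathConnected ⟨0, by simp⟩)
  refine ⟨inferInstance, fun p q => ?_⟩
  exact ⟨(PathConnectedSpace.somePath p.1 q.1).prod (PathConnectedSpace.somePath p.2 q.2)⟩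

/-! ### Generic maps -/

section Generic

variable {E H M E' H' N : Type*}
  [NormedAddCommGroup E] [NormedSpace ℝ E] [TopologicalSpace H]
  [TopologicalSpace M] [ChartedSpace H M]
  [NormedAddCommGroup E'] [NormedSpace ℝ E'] [TopologicalSpace H']
  [TopologicalSpace N] [ChartedSpace H' N]

/-- The image of the tangent space at `m` under the derivative of `F`, as a subspace of the model
vector space of `N` (which is the tangent space of `N` at `F m`). -/
def tangentImage (J : ModelWithCorners ℝ E H) (K : ModelWithCorners ℝ E' H') (F : M → N) (m : M) :
    Submodule ℝ E' :=
  LinearMap.range (mfderiv J K F m : E →L[ℝ] E').toLinearMap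

/-- Generic maps in the range of dimensions `3 → 6`: smooth immersions whose only
multiple points are transverse double points. Interior points go to interior points. -/
structure IsGeneric (J : ModelWithCorners ℝ E H) (K : ModelWithCorners ℝ E' H') (F : M → N) :
    Prop where
  smooth : ContMDiff J K ∞ F
  immersion : ∀ m, Function.Injective (mfderiv J K F m)
  transverse : ∀ x y, x ≠ y → F x = F y → tangentImage J K F x ⊔ tangentImage J K F y = ⊤
  no_triple : ∀ x y z, F x = F y → F y = F z → x = y ∨ y = z ∨ x = z
  interior : ∀ m, J.IsInteriorPoint m → K.IsInteriorPoint (F m)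

end Generic

/-- The double points of a map, as points of its image. -/
def doublePoints {M N : Type*} (F : M → N) : Set N :=
  {p | ∃ x y, x ≠ y ∧ F x = p ∧ F y = p}

/-! ### The 2-torsion subset and self-intersection sums -/

section Pi1

variable {X : Type*} [TopologicalSpace X]

/-- `T_X`, the elements of order exactly two in `π₁(X, x₀)`. -/
def twoTorsion (x₀ : X) : Set (FundamentalGroup X x₀) := {g | g ^ 2 = 1 ∧ g ≠ 1}

/-- `𝔽₂ T_X`, the `𝔽₂`-vector space with basis `T_X`. -/
abbrev F2T (x₀ : X) : Type _ := twoTorsion x₀ →₀ ZMod 2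

variable {M V : Type*} [TopologicalSpace M] [PathConnectedSpace M] [TopologicalSpace V]

/-- The based loop in `X` of a double point `F x = F y`: an arc `a` from the basepoint `m₀` to `x`,
an arc `b` from `x` to `y`, and the image of `a` backwards. -/
def doubleLoop (F : C(M, X × V)) {m₀ : M} {x₀ : X} (h₀ : (F m₀).1 = x₀) {x y : M}
    (hxy : F x = F y) (a : Path m₀ x) (b : Path x y) : Path x₀ x₀ :=
  let φ : C(M, X) := ContinuousMap.fst.comp F
  ((a.map φ.continuous).trans
    ((b.map φ.continuous).trans
      ((a.symm.map φ.continuous).cast (congrArg Prod.fst hxy.symm) rfl))).cast h₀.symm h₀.symm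

/-- The element `g_p` of `π₁(X, x₀)` of a double point `p` of `F`, for a choice of order of the two
preimages and of arcs. -/
def doubleElt (F : C(M, X × V)) {m₀ : M} {x₀ : X} (h₀ : (F m₀).1 = x₀) (p : doublePoints F) :
    FundamentalGroup X x₀ :=
  let x := p.2.choose
  let y := p.2.choose_spec.choose
  have h := p.2.choose_spec.choose_spec
  FundamentalGroup.fromPath <| Path.Homotopic.Quotient.mk <|
    doubleLoop F h₀ (x := x) (y := y) (h.2.1.trans h.2.2.symm)
      (PathConnectedSpace.somePath m₀ x) (PathConnectedSpace.somePath x y)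

open Classical in
/-- The self-intersection sum `∑ g_p ∈ 𝔽₂ T_X` over the double points `p` of `F` with
`g_p ∈ T_X`. (Exchanging the two preimages of `p` inverts `g_p`, so the summand is well defined; in
`ℤπ₁(X) / ⟨g + g⁻¹, 1⟩` the double points with `g_p² ≠ 1` cancel by sign.) -/
def selfIntersection (F : C(M, X × V)) {m₀ : M} {x₀ : X} (h₀ : (F m₀).1 = x₀) : F2T x₀ :=
  ∑ᶠ p : doublePoints F,
    if h : doubleElt F h₀ p ∈ twoTorsion x₀ then
      Finsupp.single (⟨doubleElt F h₀ p, h⟩ : twoTorsion x₀) (1 : ZMod 2)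
    else 0

end Pi1

/-! ### `μ₃` and `fq` -/

section Invariants

variable {HX X : Type*} [TopologicalSpace HX] [TopologicalSpace X] [ChartedSpace HX X]

/-- `ℝ²`. -/
abbrev Plane : Type := EuclideanSpace ℝ (Fin 2)

/-- A generic based map `S³ → X × ℝ²`. -/
structure IsGenericSphere (I : ModelWithCorners ℝ (EuclideanSpace ℝ (Fin 4)) HX) (x₀ : X)
    (f : C(Sph 3, X × Plane)) : Prop where
  generic : IsGeneric (𝓡 3) (I.prod (𝓡 2)) f
  based : (f (pole 3)).1 = x₀

/-- `μ₃(f)`, computed from the generic based map `f : S³ → X × ℝ²`. -/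
def mu3 {I : ModelWithCorners ℝ (EuclideanSpace ℝ (Fin 4)) HX} {x₀ : X}
    {f : C(Sph 3, X × Plane)} (hf : IsGenericSphere I x₀ f) : F2T x₀ :=
  selfIntersection f hf.based

/-- The subspace `μ₃(π₃(X))` of `𝔽₂ T_X`. Every element of `π₃(X)` is represented by
(the first component of) a generic based map `S³ → X × ℝ²`. -/
def mu3Image (I : ModelWithCorners ℝ (EuclideanSpace ℝ (Fin 4)) HX) (x₀ : X) :
    Submodule (ZMod 2) (F2T x₀) :=
  Submodule.span (ZMod 2) {v | ∃ f, ∃ hf : IsGenericSphere I x₀ f, mu3 hf = v}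

/-- A smoothly embedded based 2-sphere in (the interior of) `X`. -/
structure IsBasedSphere (I : ModelWithCorners ℝ (EuclideanSpace ℝ (Fin 4)) HX) (x₀ : X)
    (S : Sph 2 → X) : Prop where
  embedding : Manifold.IsSmoothEmbedding (𝓡 2) I ∞ S
  interior : ∀ z, I.IsInteriorPoint (S z)
  based : S (pole 2) = x₀

/-- A generic based map `H : S² × I → X × ℝ × I` from `S₀ × 0 × 0` to `S₁ × 0 × 1`, such as a
generic perturbation of the track of a based homotopy. -/
structure IsGenericTrack (I : ModelWithCorners ℝ (EuclideanSpace ℝ (Fin 4)) HX) (x₀ : X)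
    (S₀ S₁ : Sph 2 → X) (H : C(Sph 2 × unitInterval, X × (ℝ × unitInterval))) : Prop where
  generic : IsGeneric ((𝓡 2).prod (𝓡∂ 1)) (I.prod (𝓘(ℝ, ℝ).prod (𝓡∂ 1))) H
  start : ∀ z, H (z, 0) = (S₀ z, 0, 0)
  finish : ∀ z, H (z, 1) = (S₁ z, 0, 1)
  based : ∀ t, (H (pole 2, t)).1 = x₀

/-- `fq(S₀, S₁) ∈ 𝔽₂ T_X / μ₃(π₃(X))`, computed from the generic track `H`. -/
def fq {I : ModelWithCorners ℝ (EuclideanSpace ℝ (Fin 4)) HX} {x₀ : X}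
    {S₀ S₁ : Sph 2 → X} {H : C(Sph 2 × unitInterval, X × (ℝ × unitInterval))}
    (hH : IsGenericTrack I x₀ S₀ S₁ H) : F2T x₀ ⧸ mu3Image I x₀ :=
  (mu3Image I x₀).mkQ (selfIntersection H (m₀ := (pole 2, 0)) (hH.based 0))

end Invariants

/-! ### Lifts to the universal cover -/

section Cover

variable {X Xt : Type*} [TopologicalSpace X] [TopologicalSpace Xt]

/-- The action of `g ∈ π₁(X, x₀)` on the universal cover `(Xt, xt₀)` by deck transformations: `z` is
sent to the endpoint of the lift, starting at `xt₀`, of `g` followed by the projection of a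
path from `xt₀` to `z`. -/
def deck [SimplyConnectedSpace Xt] {π : Xt → X} (hπ : IsCoveringMap π) {xt₀ : Xt} {x₀ : X}
    (h₀ : π xt₀ = x₀) (g : FundamentalGroup X x₀) (z : Xt) : Xt :=
  let γ : Path x₀ x₀ := Quotient.out (FundamentalGroup.toPath g)
  let α : Path x₀ (π z) :=
    ((PathConnectedSpace.somePath xt₀ z).map hπ.continuous).cast h₀.symm rfl
  hπ.liftPath (γ.trans α : Path x₀ (π z)).toContinuousMap xt₀ ((γ.trans α).source.trans h₀.symm) 1

variable {M V : Type*} [TopologicalSpace M] [TopologicalSpace V]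

/-- `Ft` is the lift of `F` to `Xt × V` that takes the basepoint `m₀` to (a point over) `xt₀`. -/
structure IsBasedLift (π : Xt → X) (xt₀ : Xt) (m₀ : M) (F : C(M, X × V)) (Ft : C(M, Xt × V)) :
    Prop where
  lifts : ∀ m, Prod.map π id (Ft m) = F m
  based : (Ft m₀).1 = xt₀

variable [SimplyConnectedSpace Xt] {π : Xt → X} (hπ : IsCoveringMap π) {xt₀ : Xt} {x₀ : X}
  (h₀ : π xt₀ = x₀)

/-- `Y_g = g · Y_1`, where `Y_1` is the image of the based lift `Ft`. -/
def translate (Ft : C(M, Xt × V)) (g : FundamentalGroup X x₀) : Set (Xt × V) :=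
  Prod.map (deck hπ h₀ g) id '' Set.range Ft

/-- `Y_1 ∩ Y_g`. -/
def meet (Ft : C(M, Xt × V)) (g : FundamentalGroup X x₀) : Set (Xt × V) :=
  Set.range Ft ∩ translate hπ h₀ Ft g

/-- The double points of `F` and of its lifts are isolated (the spaces being Hausdorff and the
source compact: there are finitely many), and the number of points of `Y_1 ∩ Y_g` is even for every
`g ∈ T_X`. -/
structure HasIsolatedDoublePoints (F : C(M, X × V)) (Ft : C(M, Xt × V)) : Prop where
  base : (doublePoints F).Finite
  lift : (doublePoints Ft).Finite
  meet_finite : ∀ g : FundamentalGroup X x₀, g ≠ 1 → (meet hπ h₀ Ft g).Finite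
  finitely_many : {g : FundamentalGroup X x₀ | g ≠ 1 ∧ (meet hπ h₀ Ft g).Nonempty}.Finite
  meet_even : ∀ g ∈ twoTorsion x₀, Even (meet hπ h₀ Ft g).ncard

/-- `∑_{g ∈ T_X} ½ |Y_1 ∩ Y_g| · g ∈ 𝔽₂ T_X`. -/
def coverSum (Ft : C(M, Xt × V)) : F2T x₀ :=
  ∑ᶠ g : twoTorsion x₀, Finsupp.single g (((meet hπ h₀ Ft g.1).ncard / 2 : ℕ) : ZMod 2)

end Cover

end FreedmanQuinn

end

open FreedmanQuinn

open Set Filter Topology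

/-!
Read in charts, an immersion is a small Lipschitz perturbation of its injective derivative, so it is
locally injective; at a transverse double point in complementary dimensions the same applies to the
difference of the two sheets, so double points are isolated, and by compactness there are finitely
many pairs `x ≠ y` with `F x = F y`.

A path lifted to the universal cover is determined up to homotopy by its endpoints, so for such a
pair there is exactly one `g` that takes the lift of `x` to the lift of `y`, and it is the class of
the double point `F x = F y` with that order of its preimages. Hence the points of `Y_1 ∩ Y_g`
correspond to the pairs with element `g`. When `g ^ 2 = 1`, exchanging `x` and `y` preserves `g`, so
each double point of class `g` accounts for exactly two points of `Y_1 ∩ Y_g`.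
-/

namespace FreedmanQuinn

section Transversality

variable {E E₁ E₂ E' : Type*}
  [NormedAddCommGroup E] [NormedSpace ℝ E] [FiniteDimensional ℝ E]
  [NormedAddCommGroup E₁] [NormedSpace ℝ E₁] [FiniteDimensional ℝ E₁]
  [NormedAddCommGroup E₂] [NormedSpace ℝ E₂] [FiniteDimensional ℝ E₂]
  [NormedAddCommGroup E'] [NormedSpace ℝ E']

theorem exists_injOn_of_injective_fderivWithin {f : E → E'} {s : Set E} {x : E}
    (hf : ContDiffWithinAt ℝ 1 f s x) (hs : Convex ℝ s) (hsu : UniqueDiffOn ℝ s) (hx : x ∈ s)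
    (hinj : Function.Injective (fderivWithin ℝ f s x)) : ∃ t ∈ 𝓝[s] x, InjOn f t := by
  set φ := fderivWithin ℝ f s x
  obtain ⟨K, hK₀, hK⟩ := (φ : E →ₗ[ℝ] E').injective_iff_antilipschitz.mp hinj
  have hderiv : ∀ᶠ y in 𝓝[s] x,
      HasFDerivWithinAt (fun y => f y - φ y) (fderivWithin ℝ f s y - φ) s y := by
    have hdiff := hf.eventually (by simp)
    rw [insert_eq_of_mem hx] at hdiff
    filter_upwards [hdiff] with y hy
    exact (hy.differentiableWithinAt one_ne_zero).hasFDerivWithinAt.sub φ.hasFDerivWithinAt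
  have hcont : ContinuousWithinAt (fun y => fderivWithin ℝ f s y - φ) s x :=
    (hf.fderivWithin_right hsu (m := 0) (by simp) hx).continuousWithinAt.sub
      continuousWithinAt_const
  obtain ⟨L, hL₀, hLK⟩ := exists_between (inv_pos.mpr hK₀)
  obtain ⟨t, ht, hL⟩ := hs.exists_nhdsWithin_lipschitzOnWith_of_hasFDerivWithinAt_of_nnnorm_lt
    hderiv hcont L (by simpa [φ] using hL₀)
  exact ⟨t, ht, injOn_iff_injective.mpr
    ((hK.domRestrict t).add_sub_lipschitzWith hL.to_restrict hLK).injective⟩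

theorem injective_coprod_of_range_sup_range_eq_top
    (hdim : Module.finrank ℝ E' = Module.finrank ℝ E₁ + Module.finrank ℝ E₂)
    {A : E₁ →ₗ[ℝ] E'} {B : E₂ →ₗ[ℝ] E'} (h : A.range ⊔ B.range = ⊤) :
    Function.Injective (A.coprod B) := by
  have hsurj : Function.Surjective (A.coprod B) := by
    rw [← LinearMap.range_eq_top, LinearMap.range_coprod, h]
  have : FiniteDimensional ℝ E' := .of_surjective _ hsurj
  exact (LinearMap.injective_iff_surjective_of_finrank_eq_finrank
    (by rw [Module.finrank_prod, hdim])).mpr hsurj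

theorem eventually_nhdsWithin_eq_of_range_fderivWithin_sup_eq_top
    (hdim : Module.finrank ℝ E' = Module.finrank ℝ E₁ + Module.finrank ℝ E₂)
    {f₁ : E₁ → E'} {f₂ : E₂ → E'} {s₁ : Set E₁} {s₂ : Set E₂} {u : E₁} {v : E₂}
    (h₁ : ContDiffWithinAt ℝ 1 f₁ s₁ u) (h₂ : ContDiffWithinAt ℝ 1 f₂ s₂ v)
    (hs₁ : Convex ℝ s₁) (hs₂ : Convex ℝ s₂) (hsu₁ : UniqueDiffOn ℝ s₁) (hsu₂ : UniqueDiffOn ℝ s₂)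
    (hu : u ∈ s₁) (hv : v ∈ s₂) (huv : f₁ u = f₂ v)
    (htr : (fderivWithin ℝ f₁ s₁ u).toLinearMap.range ⊔
      (fderivWithin ℝ f₂ s₂ v).toLinearMap.range = ⊤) :
    ∀ᶠ q in 𝓝[s₁ ×ˢ s₂] (u, v), f₁ q.1 = f₂ q.2 → q = (u, v) := by
  set A := fderivWithin ℝ f₁ s₁ u
  set B := fderivWithin ℝ f₂ s₂ v
  let G : E₁ × E₂ → E' := fun q => f₁ q.1 - f₂ q.2
  have hfst : MapsTo Prod.fst (s₁ ×ˢ s₂) s₁ := fun _ hq => hq.1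
  have hsnd : MapsTo Prod.snd (s₁ ×ˢ s₂) s₂ := fun _ hq => hq.2
  have hmem : (u, v) ∈ s₁ ×ˢ s₂ := ⟨hu, hv⟩
  have hsu := hsu₁.prod hsu₂
  have hG : ContDiffWithinAt ℝ 1 G (s₁ ×ˢ s₂) (u, v) :=
    (ContDiffWithinAt.comp (u, v) h₁ contDiffWithinAt_fst hfst).sub
      (ContDiffWithinAt.comp (u, v) h₂ contDiffWithinAt_snd hsnd)
  have hA : HasFDerivWithinAt f₁ A s₁ u :=
    (h₁.differentiableWithinAt one_ne_zero).hasFDerivWithinAt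
  have hB : HasFDerivWithinAt f₂ B s₂ v :=
    (h₂.differentiableWithinAt one_ne_zero).hasFDerivWithinAt
  have hG' : HasFDerivWithinAt G (A.coprod (-B)) (s₁ ×ˢ s₂) (u, v) := by
    refine ((HasFDerivWithinAt.comp (u, v) (f := Prod.fst) hA hasFDerivWithinAt_fst hfst).sub
      (HasFDerivWithinAt.comp (u, v) (f := Prod.snd) hB hasFDerivWithinAt_snd hsnd)).congr_fderiv ?_
    ext <;> simp
  have hinj : Function.Injective (fderivWithin ℝ G (s₁ ×ˢ s₂) (u, v)) := by
    rw [hG'.fderivWithin (hsu _ hmem)]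
    exact injective_coprod_of_range_sup_range_eq_top (A := A.toLinearMap) (B := -B.toLinearMap)
      hdim (by rwa [LinearMap.range_neg])
  obtain ⟨t, ht, hGt⟩ := exists_injOn_of_injective_fderivWithin hG (hs₁.prod hs₂) hsu hmem hinj
  filter_upwards [ht] with q hq hfq
  exact hGt hq (mem_of_mem_nhdsWithin hmem ht)
    ((sub_eq_zero.mpr hfq).trans (sub_eq_zero.mpr huv).symm)

variable {H H₁ H₂ H' M M₁ M₂ N : Type*}
  [TopologicalSpace H] [TopologicalSpace M] [ChartedSpace H M]
  [TopologicalSpace H₁] [TopologicalSpace M₁] [ChartedSpace H₁ M₁]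
  [TopologicalSpace H₂] [TopologicalSpace M₂] [ChartedSpace H₂ M₂]
  [TopologicalSpace H'] [TopologicalSpace N] [ChartedSpace H' N]
  {J : ModelWithCorners ℝ E H} {J₁ : ModelWithCorners ℝ E₁ H₁} {J₂ : ModelWithCorners ℝ E₂ H₂}
  {K : ModelWithCorners ℝ E' H'}

theorem exists_injOn_nhds_of_injective_mfderiv {F : M → N} {x : M} (hF : ContMDiffAt J K 1 F x)
    (hinj : Function.Injective (mfderiv J K F x)) : ∃ t ∈ 𝓝 x, InjOn F t := by
  rw [(hF.mdifferentiableAt one_ne_zero).mfderiv] at hinj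
  obtain ⟨u, hu, hFu⟩ := exists_injOn_of_injective_fderivWithin (contMDiffAt_iff.mp hF).2
    J.convex_range J.uniqueDiffOn (mem_range_self _) hinj
  refine ⟨extChartAt J x ⁻¹' u ∩ (extChartAt J x).source,
    inter_mem ((map_extChartAt_nhds x).le hu) (extChartAt_source_mem_nhds x), ?_⟩
  rintro a ⟨ha, ha'⟩ b ⟨hb, hb'⟩ hab
  refine (extChartAt J x).injOn ha' hb' (hFu ha hb ?_)
  simp only [Function.comp_apply, (extChartAt J x).left_inv ha', (extChartAt J x).left_inv hb', hab]

theorem eventually_eq_of_tangentImage_sup_eq_top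
    (hdim : Module.finrank ℝ E' = Module.finrank ℝ E₁ + Module.finrank ℝ E₂)
    {F₁ : M₁ → N} {F₂ : M₂ → N} {x : M₁} {y : M₂}
    (h₁ : ContMDiffAt J₁ K 1 F₁ x) (h₂ : ContMDiffAt J₂ K 1 F₂ y) (hxy : F₁ x = F₂ y)
    (htr : tangentImage J₁ K F₁ x ⊔ tangentImage J₂ K F₂ y = ⊤) :
    ∀ᶠ q in 𝓝 (x, y), F₁ q.1 = F₂ q.2 → q = (x, y) := by
  rw [tangentImage, tangentImage, (h₁.mdifferentiableAt one_ne_zero).mfderiv,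
    (h₂.mdifferentiableAt one_ne_zero).mfderiv] at htr
  have hcharts : Tendsto (Prod.map (extChartAt J₁ x) (extChartAt J₂ y)) (𝓝 (x, y))
      (𝓝[range J₁ ×ˢ range J₂] (extChartAt J₁ x x, extChartAt J₂ y y)) := by
    rw [nhds_prod_eq, nhdsWithin_prod_eq]
    exact Tendsto.prodMap (map_extChartAt_nhds x).le (map_extChartAt_nhds y).le
  have hunique := hcharts.eventually <| eventually_nhdsWithin_eq_of_range_fderivWithin_sup_eq_top
    hdim (contMDiffAt_iff.mp h₁).2 (contMDiffAt_iff.mp h₂).2 J₁.convex_range J₂.convex_range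
    J₁.uniqueDiffOn J₂.uniqueDiffOn (mem_range_self _) (mem_range_self _)
    (by simp only [Function.comp_apply, extChartAt_to_inv, hxy]) htr
  filter_upwards [hunique, prod_mem_nhds (extChartAt_source_mem_nhds (I := J₁) x)
    (extChartAt_source_mem_nhds (I := J₂) y)] with ⟨a, b⟩ hab ⟨ha, hb⟩ hFab
  have heq := hab (by
    simp only [Function.comp_apply, Prod.map_apply, (extChartAt J₁ x).left_inv ha,
      (extChartAt J₂ y).left_inv hb, hFab, hxy])
  exact Prod.ext ((extChartAt J₁ x).injOn ha (mem_extChartAt_source x) (Prod.ext_iff.mp heq).1)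
    ((extChartAt J₂ y).injOn hb (mem_extChartAt_source y) (Prod.ext_iff.mp heq).2)

end Transversality

/-- The ordered pairs of distinct points with the same image. A double point of a map without triple
points is the common image of exactly two of them. -/
def doublePairs {M N : Type*} (F : M → N) : Set (M × M) := {q | q.1 ≠ q.2 ∧ F q.1 = F q.2}

section Finiteness

theorem finite_doublePairs {M N : Type*} [TopologicalSpace M] [CompactSpace M] [TopologicalSpace N]
    [T2Space N] {F : M → N} (hF : Continuous F) (hinj : ∀ x, ∃ t ∈ 𝓝 x, InjOn F t)
    (hisol : ∀ q₀ ∈ doublePairs F, ∀ᶠ q in 𝓝 q₀, F q.1 = F q.2 → q = q₀) :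
    (doublePairs F).Finite := by
  by_contra hinf
  obtain ⟨⟨x, y⟩, hacc⟩ := Set.Infinite.exists_accPt_principal hinf
  suffices h : ∀ᶠ q in 𝓝 (x, y), q ∈ doublePairs F → q = (x, y) from
    accPt_iff_frequently.mp hacc (h.mono fun q hq hne => hne.1 (hq hne.2))
  by_cases hxy : F x = F y
  · rcases eq_or_ne x y with rfl | hne
    · obtain ⟨t, ht, hFt⟩ := hinj x
      filter_upwards [prod_mem_nhds ht ht] with q hqt hq
      exact (hq.1 (hFt hqt.1 hqt.2 hq.2)).elim
    · exact (hisol (x, y) ⟨hne, hxy⟩).mono fun q hq hmem => hq hmem.2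
  · have hne : ∀ᶠ q in 𝓝 (x, y), F q.1 ≠ F q.2 :=
      (isOpen_ne_fun (hF.comp continuous_fst) (hF.comp continuous_snd)).mem_nhds hxy
    exact hne.mono fun q hq hmem => (hq hmem.2).elim

variable {E H M E' H' N : Type*} [NormedAddCommGroup E] [NormedSpace ℝ E] [FiniteDimensional ℝ E]
  [TopologicalSpace H] [TopologicalSpace M] [ChartedSpace H M]
  [NormedAddCommGroup E'] [NormedSpace ℝ E'] [TopologicalSpace H']
  [TopologicalSpace N] [ChartedSpace H' N]
  {J : ModelWithCorners ℝ E H} {K : ModelWithCorners ℝ E' H'} {F : M → N}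

theorem IsGeneric.finite_doublePairs [CompactSpace M] [T2Space N] (hF : IsGeneric J K F)
    (hdim : Module.finrank ℝ E' = 2 * Module.finrank ℝ E) : (doublePairs F).Finite := by
  have hF₁ : ContMDiff J K 1 F := hF.smooth.of_le (by exact_mod_cast le_top)
  exact FreedmanQuinn.finite_doublePairs hF.smooth.continuous
    (fun x => exists_injOn_nhds_of_injective_mfderiv (hF₁ x) (hF.immersion x))
    fun q hq => eventually_eq_of_tangentImage_sup_eq_top (hdim.trans (two_mul _)) (hF₁ q.1)
      (hF₁ q.2) hq.2 (hF.transverse q.1 q.2 hq.1 hq.2)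

end Finiteness

section Monodromy

variable {X Xt : Type*} [TopologicalSpace X] [TopologicalSpace Xt] {π : Xt → X}
  (hπ : IsCoveringMap π)

theorem exists_monodromy_eq [PathConnectedSpace Xt] {x : X} (e : π ⁻¹' {x}) (z : Xt) :
    ∃ (y : X) (γ : Path.Homotopic.Quotient x y), (hπ.monodromy γ e : Xt) = z := by
  obtain ⟨e, rfl⟩ := e
  exact ⟨π z, _, congrArg Subtype.val (hπ.monodromy_map (.mk (PathConnectedSpace.somePath e z)))⟩

variable [SimplyConnectedSpace Xt]

theorem eq_map_of_monodromy_eq {z w : Xt} {γ : Path.Homotopic.Quotient (π z) (π w)}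
    (h : hπ.monodromy γ ⟨z, rfl⟩ = ⟨w, rfl⟩) (Γ : Path.Homotopic.Quotient z w) :
    γ = Γ.map ⟨π, hπ.continuous⟩ := by
  suffices key : ∀ {y : X} (δ : Path.Homotopic.Quotient (π z) y) (w' : π ⁻¹' {y}),
      hπ.monodromy δ ⟨z, rfl⟩ = w' → ∀ Δ : Path.Homotopic.Quotient z w'.1,
        δ.cast rfl w'.2 = Δ.map ⟨π, hπ.continuous⟩ by
    simpa using key γ _ h Γ
  rintro y δ _ rfl Δ
  exact (hπ.map_liftPathQuotient δ ⟨z, rfl⟩).symm.trans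
    (congrArg (·.map ⟨π, hπ.continuous⟩) (Subsingleton.elim _ Δ))

theorem monodromy_left_injective {x y : X} (e : π ⁻¹' {x}) :
    Function.Injective fun γ : Path.Homotopic.Quotient x y => hπ.monodromy γ e := by
  intro γ γ' h
  obtain ⟨z, rfl⟩ := e
  obtain ⟨⟨w, rfl⟩, hw⟩ : ∃ w, hπ.monodromy γ ⟨z, rfl⟩ = w := ⟨_, rfl⟩
  have Γ : Path.Homotopic.Quotient z w := .mk (PathConnectedSpace.somePath z w)
  exact (eq_map_of_monodromy_eq hπ hw Γ).trans
    (eq_map_of_monodromy_eq hπ (h.symm.trans hw) Γ).symm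

end Monodromy

section Deck

variable {X Xt : Type*} [TopologicalSpace X] [TopologicalSpace Xt] [SimplyConnectedSpace Xt]
  {π : Xt → X} (hπ : IsCoveringMap π) {xt₀ : Xt} {x₀ : X} (h₀ : π xt₀ = x₀)

theorem deck_monodromy (g : FundamentalGroup X x₀) {y : X} (γ : Path.Homotopic.Quotient x₀ y) :
    deck hπ h₀ g (hπ.monodromy γ ⟨xt₀, h₀⟩) =
      hπ.monodromy (Path.Homotopic.Quotient.trans g.toPath γ) ⟨xt₀, h₀⟩ := by
  subst h₀
  obtain ⟨⟨z, rfl⟩, hz⟩ : ∃ z, hπ.monodromy γ ⟨xt₀, rfl⟩ = z := ⟨_, rfl⟩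
  rw [hz, eq_map_of_monodromy_eq hπ hz (.mk (PathConnectedSpace.somePath xt₀ z)),
    show g.toPath = .mk (Quotient.out g.toPath) from (Quotient.out_eq g.toPath).symm]
  rfl

theorem deck_one (z : Xt) : deck hπ h₀ 1 z = z := by
  obtain ⟨y, γ, rfl⟩ := exists_monodromy_eq hπ ⟨xt₀, h₀⟩ z
  rw [deck_monodromy, FundamentalGroup.one_def]
  exact congrArg (fun q => (hπ.monodromy q _ : Xt)) (Path.Homotopic.Quotient.refl_trans γ)

/-- The order is reversed because in Mathlib `g * h` is the class of `h` followed by `g`. -/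
theorem deck_mul (g h : FundamentalGroup X x₀) (z : Xt) :
    deck hπ h₀ (g * h) z = deck hπ h₀ h (deck hπ h₀ g z) := by
  obtain ⟨y, γ, rfl⟩ := exists_monodromy_eq hπ ⟨xt₀, h₀⟩ z
  rw [deck_monodromy, deck_monodromy, deck_monodromy, FundamentalGroup.mul_def]
  exact congrArg (fun q => (hπ.monodromy q _ : Xt)) (Path.Homotopic.Quotient.trans_assoc _ _ _)

theorem proj_deck (g : FundamentalGroup X x₀) (z : Xt) : π (deck hπ h₀ g z) = π z := by
  obtain ⟨y, γ, rfl⟩ := exists_monodromy_eq hπ ⟨xt₀, h₀⟩ z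
  rw [deck_monodromy]
  exact (hπ.monodromy _ _).2.trans (hπ.monodromy _ _).2.symm

theorem deck_left_injective (z : Xt) :
    Function.Injective fun g : FundamentalGroup X x₀ => deck hπ h₀ g z := by
  intro g h hgh
  obtain ⟨y, γ, rfl⟩ := exists_monodromy_eq hπ ⟨xt₀, h₀⟩ z
  simp only [deck_monodromy] at hgh
  have htrans := monodromy_left_injective hπ _ (Subtype.ext hgh)
  simpa [Path.Homotopic.Quotient.trans_assoc] using congrArg (fun q => q.trans γ.symm) htrans

theorem deck_deck_of_mem_twoTorsion {g : FundamentalGroup X x₀} (hg : g ∈ twoTorsion x₀) (z : Xt) :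
    deck hπ h₀ g (deck hπ h₀ g z) = z := by
  rw [← deck_mul, ← sq, hg.1, deck_one]

theorem deck_conj_monodromy {u v : X} (h : v = u) (α : Path.Homotopic.Quotient x₀ u)
    (β : Path.Homotopic.Quotient u v) :
    deck hπ h₀ (FundamentalGroup.fromPath (α.trans (β.trans (α.symm.cast h rfl))))
      (hπ.monodromy α ⟨xt₀, h₀⟩) = hπ.monodromy β (hπ.monodromy α ⟨xt₀, h₀⟩) := by
  subst h
  rw [deck_monodromy, ← hπ.monodromy_trans_apply]
  simp [Path.Homotopic.Quotient.trans_assoc]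

theorem deck_doubleLoop {M V : Type*} [TopologicalSpace M] [TopologicalSpace V] {m₀ : M}
    {F : C(M, X × V)} {Ft : C(M, Xt × V)} (hFt : IsBasedLift π xt₀ m₀ F Ft)
    (hF₀ : (F m₀).1 = x₀) {x y : M} (hxy : F x = F y) (a : Path m₀ x) (b : Path x y) :
    deck hπ h₀ (FundamentalGroup.fromPath (.mk (doubleLoop F hF₀ hxy a b))) (Ft x).1 =
      (Ft y).1 := by
  obtain ⟨hlift, rfl⟩ := hFt
  obtain rfl : (ContinuousMap.prodMap ⟨π, hπ.continuous⟩ (.id V)).comp Ft = F :=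
    ContinuousMap.ext hlift
  subst h₀
  let ψ : C(M, Xt) := ContinuousMap.fst.comp Ft
  have ha := hπ.monodromy_map (.mk (a.map ψ.continuous))
  have hb := hπ.monodromy_map (.mk (b.map ψ.continuous))
  have hab := deck_conj_monodromy hπ rfl (congrArg Prod.fst hxy).symm
    (.map (.mk (a.map ψ.continuous)) ⟨π, hπ.continuous⟩)
    (.map (.mk (b.map ψ.continuous)) ⟨π, hπ.continuous⟩)
  exact ((congrArg _ (congrArg Subtype.val ha)).symm.trans hab).trans
    (congrArg Subtype.val ((congrArg _ ha).trans hb))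

end Deck

section Pairs

variable {M N : Type*} {F : M → N}

/-- No three distinct points have the same image, in the form used by `IsGeneric`. -/
def NoTriplePoints (F : M → N) : Prop :=
  ∀ x y z, F x = F y → F y = F z → x = y ∨ y = z ∨ x = z

theorem finite_doublePoints (hfin : (doublePairs F).Finite) : (doublePoints F).Finite := by
  refine (hfin.image fun q => F q.1).subset ?_
  rintro p ⟨x, y, hne, hx, hy⟩
  exact ⟨(x, y), ⟨hne, hx.trans hy.symm⟩, hx⟩

/-- The two preimages of a double point, in the order in which `doubleElt` chooses them. -/
noncomputable def preimagePair (p : doublePoints F) : M × M :=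
  (p.2.choose, p.2.choose_spec.choose)

theorem map_preimagePair_fst (p : doublePoints F) : F (preimagePair p).1 = p :=
  p.2.choose_spec.choose_spec.2.1

theorem map_preimagePair_snd (p : doublePoints F) : F (preimagePair p).2 = p :=
  p.2.choose_spec.choose_spec.2.2

theorem preimagePair_mem_doublePairs (p : doublePoints F) : preimagePair p ∈ doublePairs F :=
  ⟨p.2.choose_spec.choose_spec.1, (map_preimagePair_fst p).trans (map_preimagePair_snd p).symm⟩

theorem preimagePair_injective : Function.Injective (preimagePair (F := F)) := fun p p' h =>
  Subtype.ext <| (map_preimagePair_fst p).symm.trans <|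
    (congrArg (fun q => F q.1) h).trans (map_preimagePair_fst p')

theorem preimagePair_ne_swap (p p' : doublePoints F) :
    preimagePair p ≠ (preimagePair p').swap := by
  intro h
  obtain rfl : p = p' := Subtype.ext <| (map_preimagePair_fst p).symm.trans <|
    (congrArg (fun q => F q.1) h).trans (map_preimagePair_snd p')
  exact (preimagePair_mem_doublePairs p).1 (congrArg Prod.fst h)

theorem exists_preimagePair_eq_or_eq_swap (hF : NoTriplePoints F) {q : M × M}
    (hq : q ∈ doublePairs F) :
    ∃ p : doublePoints F, preimagePair p = q ∨ preimagePair p = q.swap := by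
  obtain ⟨x, y⟩ := q
  obtain ⟨hxy, hFxy⟩ : x ≠ y ∧ F x = F y := hq
  let p : doublePoints F := ⟨F x, x, y, hxy, rfl, hFxy.symm⟩
  have hx := hF _ _ x (preimagePair_mem_doublePairs p).2 (map_preimagePair_snd p)
  have hy := hF _ _ y (preimagePair_mem_doublePairs p).2 ((map_preimagePair_snd p).trans hFxy)
  have hne := (preimagePair_mem_doublePairs p).1
  refine ⟨p, ?_⟩
  simp only [Prod.ext_iff, Prod.fst_swap, Prod.snd_swap]
  grind

end Pairs

section SheetPairs

variable {X Xt M V : Type*} [TopologicalSpace X] [TopologicalSpace Xt] [SimplyConnectedSpace Xt]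
  [TopologicalSpace M] [TopologicalSpace V]
  {π : Xt → X} (hπ : IsCoveringMap π) {xt₀ : Xt} {x₀ : X} (h₀ : π xt₀ = x₀)
  {m₀ : M} {F : C(M, X × V)} {Ft : C(M, Xt × V)} {g h : FundamentalGroup X x₀}

/-- The double pairs `(x, y)` of `F` for which `g` takes the lift of `x` to the lift of `y`; they
parametrize `Y_1 ∩ Y_g`. -/
def sheetPairs (F : C(M, X × V)) (Ft : C(M, Xt × V)) (g : FundamentalGroup X x₀) : Set (M × M) :=
  {q ∈ doublePairs F | deck hπ h₀ g (Ft q.1).1 = (Ft q.2).1}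

theorem eq_of_mem_sheetPairs {q : M × M} (hg : q ∈ sheetPairs hπ h₀ F Ft g)
    (hh : q ∈ sheetPairs hπ h₀ F Ft h) : g = h :=
  deck_left_injective hπ h₀ (Ft q.1).1 (hg.2.trans hh.2.symm)

theorem swap_mem_sheetPairs (hg : g ∈ twoTorsion x₀) {q : M × M}
    (hq : q ∈ sheetPairs hπ h₀ F Ft g) : q.swap ∈ sheetPairs hπ h₀ F Ft g :=
  ⟨⟨hq.1.1.symm, hq.1.2.symm⟩, by
    rw [Prod.fst_swap, Prod.snd_swap, ← hq.2, deck_deck_of_mem_twoTorsion hπ h₀ hg]⟩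

theorem lift_ne_of_deck_eq (hg : g ≠ 1) {x y : M} (hxy : deck hπ h₀ g (Ft x).1 = (Ft y).1) :
    Ft x ≠ Ft y := fun heq =>
  hg (deck_left_injective hπ h₀ (Ft x).1 <|
    hxy.trans <| (congrArg Prod.fst heq).symm.trans (deck_one hπ h₀ _).symm)

theorem meet_eq_image_sheetPairs (hFt : IsBasedLift π xt₀ m₀ F Ft) (hg : g ≠ 1) :
    meet hπ h₀ Ft g = (fun q => Ft q.2) '' sheetPairs hπ h₀ F Ft g := by
  ext r
  constructor
  · rintro ⟨⟨y, rfl⟩, _, ⟨x, rfl⟩, hxy⟩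
    obtain ⟨hdeck, hV⟩ : deck hπ h₀ g (Ft x).1 = (Ft y).1 ∧ (Ft x).2 = (Ft y).2 :=
      Prod.ext_iff.mp hxy
    have hF : F x = F y := by
      rw [← hFt.lifts x, ← hFt.lifts y]
      exact Prod.ext ((proj_deck hπ h₀ g _).symm.trans (congrArg π hdeck)) hV
    exact ⟨(x, y), ⟨⟨ne_of_apply_ne Ft (lift_ne_of_deck_eq hπ h₀ hg hdeck), hF⟩, hdeck⟩, rfl⟩
  · rintro ⟨⟨x, y⟩, ⟨⟨-, hF : F x = F y⟩, hdeck⟩, rfl⟩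
    rw [← hFt.lifts x, ← hFt.lifts y] at hF
    exact ⟨⟨y, rfl⟩, Ft x, ⟨x, rfl⟩, Prod.ext hdeck (congrArg Prod.snd hF :)⟩

theorem injOn_sheetPairs (hF : NoTriplePoints F) (hFt : IsBasedLift π xt₀ m₀ F Ft) (hg : g ≠ 1) :
    InjOn (fun q => Ft q.2) (sheetPairs hπ h₀ F Ft g) := by
  rintro ⟨x, y⟩ ⟨⟨hne, hxy⟩, hdeck⟩ ⟨x', y'⟩ ⟨⟨hne', hxy'⟩, -⟩ (hy : Ft y = Ft y')
  dsimp only at hne hxy hdeck hne' hxy'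
  have hFy : F y = F y' := by rw [← hFt.lifts y, ← hFt.lifts y', hy]
  have hxy'_ne : x ≠ y' := by
    rintro rfl
    exact lift_ne_of_deck_eq hπ h₀ hg hdeck hy.symm
  obtain rfl : y = y' := by
    have := hF y y' x hFy (hFy.symm.trans hxy.symm)
    grind
  obtain rfl : x = x' := by
    have := hF x x' y (hxy.trans hxy'.symm) hxy'
    grind
  rfl

theorem finite_meet (hfin : (doublePairs F).Finite) (hFt : IsBasedLift π xt₀ m₀ F Ft)
    (hg : g ≠ 1) : (meet hπ h₀ Ft g).Finite := by
  rw [meet_eq_image_sheetPairs hπ h₀ hFt hg]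
  exact (hfin.subset (sep_subset _ _)).image _

theorem finite_setOf_meet_nonempty (hfin : (doublePairs F).Finite)
    (hFt : IsBasedLift π xt₀ m₀ F Ft) :
    {g : FundamentalGroup X x₀ | g ≠ 1 ∧ (meet hπ h₀ Ft g).Nonempty}.Finite := by
  have hsub (q : M × M) : {g | q ∈ sheetPairs hπ h₀ F Ft g}.Subsingleton :=
    fun _ hg _ hh => eq_of_mem_sheetPairs hπ h₀ hg hh
  refine (hfin.biUnion fun q _ => (hsub q).finite).subset ?_
  rintro g ⟨hg, hne⟩
  rw [meet_eq_image_sheetPairs hπ h₀ hFt hg, image_nonempty] at hne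
  obtain ⟨q, hq⟩ := hne
  exact mem_biUnion hq.1 hq

theorem coverSum_apply
    (hfin : {g : FundamentalGroup X x₀ | g ≠ 1 ∧ (meet hπ h₀ Ft g).Nonempty}.Finite)
    (g : twoTorsion x₀) :
    coverSum hπ h₀ Ft g = (((meet hπ h₀ Ft g.1).ncard / 2 : ℕ) : ZMod 2) := by
  have hsupp : (Function.support fun g : twoTorsion x₀ =>
      Finsupp.single g (((meet hπ h₀ Ft g.1).ncard / 2 : ℕ) : ZMod 2)).Finite := by
    refine (hfin.preimage Subtype.val_injective.injOn).subset fun k hk => ⟨k.2.2, ?_⟩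
    by_contra hempty
    rw [not_nonempty_iff_eq_empty] at hempty
    exact hk (by simp [hempty])
  have happly := (Finsupp.applyAddHom (M := ZMod 2) g).map_finsum hsupp
  simp only [Finsupp.applyAddHom_apply] at happly
  rw [coverSum, happly, finsum_eq_single _ g fun k hk => by simp [hk], Finsupp.single_eq_same]

variable [PathConnectedSpace M]

theorem selfIntersection_apply (hfin : (doublePairs F).Finite) (hF₀ : (F m₀).1 = x₀)
    (g : twoTorsion x₀) :
    selfIntersection F hF₀ g = ({p : doublePoints F | doubleElt F hF₀ p = g}.ncard : ZMod 2) := by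
  classical
  have : Finite (doublePoints F) := finite_doublePoints hfin
  have := Fintype.ofFinite (doublePoints F)
  rw [selfIntersection, finsum_eq_sum_of_fintype, Finsupp.finsetSum_apply,
    Set.ncard_eq_toFinset_card', Set.toFinset_ofPred, ← Finset.sum_boole]
  refine Finset.sum_congr rfl fun p _ => ?_
  by_cases h : doubleElt F hF₀ p ∈ twoTorsion x₀
  · simp only [dif_pos h, Finsupp.single_apply, Subtype.ext_iff]
  · rw [dif_neg h, if_neg fun hp : doubleElt F hF₀ p = g => h (hp ▸ g.2), Finsupp.coe_zero,
      Pi.zero_apply]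

theorem preimagePair_mem_sheetPairs (hFt : IsBasedLift π xt₀ m₀ F Ft) (hF₀ : (F m₀).1 = x₀)
    (p : doublePoints F) : preimagePair p ∈ sheetPairs hπ h₀ F Ft (doubleElt F hF₀ p) :=
  ⟨preimagePair_mem_doublePairs p, deck_doubleLoop hπ h₀ hFt hF₀ _ _ _⟩

theorem sheetPairs_eq_union (hF : NoTriplePoints F) (hFt : IsBasedLift π xt₀ m₀ F Ft)
    (hF₀ : (F m₀).1 = x₀) (hg : g ∈ twoTorsion x₀) :
    sheetPairs hπ h₀ F Ft g = preimagePair '' {p | doubleElt F hF₀ p = g} ∪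
      Prod.swap '' (preimagePair '' {p | doubleElt F hF₀ p = g}) := by
  refine Subset.antisymm (fun q hq => ?_) (union_subset ?_ ?_)
  · obtain ⟨p, hp⟩ := exists_preimagePair_eq_or_eq_swap hF hq.1
    have hpg := preimagePair_mem_sheetPairs hπ h₀ hFt hF₀ p
    rcases hp with hp | hp
    · rw [hp] at hpg
      exact .inl ⟨p, eq_of_mem_sheetPairs hπ h₀ hpg hq, hp⟩
    · rw [hp] at hpg
      have hpq := eq_of_mem_sheetPairs hπ h₀ hpg (swap_mem_sheetPairs hπ h₀ hg hq)
      exact .inr ⟨q.swap, ⟨p, hpq, hp⟩, q.swap_swap⟩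
  · rintro _ ⟨p, rfl, rfl⟩
    exact preimagePair_mem_sheetPairs hπ h₀ hFt hF₀ p
  · rintro _ ⟨_, ⟨p, rfl, rfl⟩, rfl⟩
    exact swap_mem_sheetPairs hπ h₀ hg (preimagePair_mem_sheetPairs hπ h₀ hFt hF₀ p)

theorem ncard_meet (hfin : (doublePairs F).Finite) (hF : NoTriplePoints F)
    (hFt : IsBasedLift π xt₀ m₀ F Ft) (hF₀ : (F m₀).1 = x₀) (hg : g ∈ twoTorsion x₀) :
    (meet hπ h₀ Ft g).ncard = 2 * {p : doublePoints F | doubleElt F hF₀ p = g}.ncard := by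
  have : Finite (doublePoints F) := finite_doublePoints hfin
  have hdisj : Disjoint (preimagePair '' {p | doubleElt F hF₀ p = g})
      (Prod.swap '' (preimagePair '' {p | doubleElt F hF₀ p = g})) := by
    rw [Set.disjoint_left]
    rintro _ ⟨p, -, rfl⟩ ⟨_, ⟨p', -, rfl⟩, h⟩
    exact preimagePair_ne_swap p p' h.symm
  rw [meet_eq_image_sheetPairs hπ h₀ hFt hg.2,
    (injOn_sheetPairs hπ h₀ hF hFt hg.2).ncard_image, sheetPairs_eq_union hπ h₀ hF hFt hF₀ hg,
    ncard_union_eq hdisj, ncard_image_of_injective _ Prod.swap_injective,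
    ncard_image_of_injective _ preimagePair_injective, two_mul]

theorem hasIsolatedDoublePoints (hfin : (doublePairs F).Finite) (hF : NoTriplePoints F)
    (hFt : IsBasedLift π xt₀ m₀ F Ft) (hF₀ : (F m₀).1 = x₀) :
    HasIsolatedDoublePoints hπ h₀ F Ft where
  base := finite_doublePoints hfin
  lift := finite_doublePoints <| hfin.subset fun q hq =>
    ⟨hq.1, by rw [← hFt.lifts, ← hFt.lifts, hq.2]⟩
  meet_finite _ hg := finite_meet hπ h₀ hfin hFt hg
  finitely_many := finite_setOf_meet_nonempty hπ h₀ hfin hFt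
  meet_even _ hg := ncard_meet hπ h₀ hfin hF hFt hF₀ hg ▸ even_two_mul _

theorem selfIntersection_eq_coverSum (hfin : (doublePairs F).Finite) (hF : NoTriplePoints F)
    (hFt : IsBasedLift π xt₀ m₀ F Ft) (hF₀ : (F m₀).1 = x₀) :
    selfIntersection F hF₀ = coverSum hπ h₀ Ft := by
  ext g
  rw [selfIntersection_apply hfin,
    coverSum_apply hπ h₀ (finite_setOf_meet_nonempty hπ h₀ hfin hFt),
    ncard_meet hπ h₀ hfin hF hFt hF₀ g.2, Nat.mul_div_cancel_left _ two_pos]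

end SheetPairs

end FreedmanQuinn

theorem proposition4p4_general {E H M E' H' X Xt V : Type*}
    [NormedAddCommGroup E] [NormedSpace ℝ E] [FiniteDimensional ℝ E] [TopologicalSpace H]
    [NormedAddCommGroup E'] [NormedSpace ℝ E'] [TopologicalSpace H']
    [TopologicalSpace M] [ChartedSpace H M] [CompactSpace M] [PathConnectedSpace M]
    [TopologicalSpace X] [TopologicalSpace V] [ChartedSpace H' (X × V)] [T2Space (X × V)]
    [TopologicalSpace Xt] [SimplyConnectedSpace Xt]
    {J : ModelWithCorners ℝ E H} {K : ModelWithCorners ℝ E' H'}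
    (hdim : Module.finrank ℝ E' = 2 * Module.finrank ℝ E)
    {π : Xt → X} (hπ : IsCoveringMap π) {xt₀ : Xt} {x₀ : X} (h₀ : π xt₀ = x₀)
    {m₀ : M} {F : C(M, X × V)} (hF : IsGeneric J K F) (hF₀ : (F m₀).1 = x₀)
    {Ft : C(M, Xt × V)} (hFt : IsBasedLift π xt₀ m₀ F Ft) :
    HasIsolatedDoublePoints hπ h₀ F Ft ∧ selfIntersection F hF₀ = coverSum hπ h₀ Ft :=
  have hfin := hF.finite_doublePairs hdim
  ⟨hasIsolatedDoublePoints hπ h₀ hfin hF.no_triple hFt hF₀,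
    selfIntersection_eq_coverSum hπ h₀ hfin hF.no_triple hFt hF₀⟩

theorem proposition4p4 {HX X Xt : Type*} [TopologicalSpace HX]
    (I : ModelWithCorners ℝ (EuclideanSpace ℝ (Fin 4)) HX)
    [TopologicalSpace X] [T2Space X] [ConnectedSpace X] [ChartedSpace HX X] [IsManifold I ∞ X]
    [TopologicalSpace Xt] [SimplyConnectedSpace Xt]
    (π : Xt → X) (hπ : IsCoveringMap π) (xt₀ : Xt) (x₀ : X) (h₀ : π xt₀ = x₀) :
    (∀ (f : C(Sph 3, X × Plane)) (hf : IsGenericSphere I x₀ f) (ft : C(Sph 3, Xt × Plane)),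
      IsBasedLift π xt₀ (pole 3) f ft →
        HasIsolatedDoublePoints hπ h₀ f ft ∧ mu3 hf = coverSum hπ h₀ ft) ∧
    (∀ (S₀ S₁ : Sph 2 → X), IsBasedSphere I x₀ S₀ → IsBasedSphere I x₀ S₁ →
      ∀ (H : C(Sph 2 × unitInterval, X × (ℝ × unitInterval)))
        (hH : IsGenericTrack I x₀ S₀ S₁ H)
        (Ht : C(Sph 2 × unitInterval, Xt × (ℝ × unitInterval))),
        IsBasedLift π xt₀ (pole 2, 0) H Ht →
          HasIsolatedDoublePoints hπ h₀ H Ht ∧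
            fq hH = (mu3Image I x₀).mkQ (coverSum hπ h₀ Ht)) :=
  ⟨fun _ hf _ hft => proposition4p4_general (by simp) hπ h₀ hf.generic hf.based hft,
    fun _ _ _ _ _ hH _ hHt =>
      (proposition4p4_general (by simp) hπ h₀ hH.generic (hH.based 0) hHt).imp_right (congrArg _)⟩
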